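/- Let $X$ be a finite simple undirected graph with $N$ vertices and adjacency matrix $d\in M_N(\{0,1\})$. Let $C(G^+(X))$ be the universal unital $\mathrm{C}^*$-algebra generated by elements $u_{ij}$ ($1\le i,j\le N$), subject to the relations that the $u_{ij}$ are projections ($u_{ij}=u_{ij}^2=u_{ij}^*$) which sum up to $1$ on each row and each column of $u=(u_{ij})$, and that $du=ud$. With the comultiplication given by $\Delta(u_{ij})=\sum_k u_{ik}\otimes u_{kj}$, this defines a compact quantum group $G^+(X)$, the quantum automorphism group of $X$. For a finite group $\Gamma$, its dual $\widehat{\Gamma}$ is the compact quantum group given by the group algebra $\mathrm{C}^*(\Gamma)=\mathbb{C}[\Gamma]$, with involution $g^*=g^{-1}$ and comultiplication $\Delta(g)=g\otimes g$ for $g\in\Gamma$. A compact quantum group $G$ has the Frucht property if $G=G^+(X)$ for some finite graph $X$, i.e. if the dense $*$-algebra $\langle u_{ij}\rangle\subset C(G^+(X))$ is isomorphic to the Hopf $*$-algebra of $G$ by a $*$-isomorphism that intertwines the comultiplications. **Theorem.** The finite duals $\widehat{S_3}$, $\widehat{A_4}$ and $\widehat{A_5}$ do not have the Frucht property: none of them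 is the quantum automorphism group of a finite graph. -/

import Mathlib

open scoped ENNReal TensorProduct

noncomputable section

/-! ### Magic matrices and the quantum automorphism group of a finite graph -/

/-- A square matrix over a `*`-algebra is magic if its entries are projections `p = p² = p*`
which sum up to `1` on every row and on every column. -/
structure IsMagic {V A : Type*} [Fintype V] [Semiring A] [StarRing A]
    (u : Matrix V V A) : Prop where
  isStarProjection : ∀ i j, IsStarProjection (u i j)
  row_sum : ∀ i, ∑ j, u i j = 1
  col_sum : ∀ j, ∑ i, u i j = 1

open Classical in
/-- The relations `u = magic`, `du = ud`, with `d` the adjacency matrix of the graph `X`. -/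
structure IsQuantumAut {V A : Type*} [Fintype V] [Semiring A] [StarRing A]
    (X : SimpleGraph V) (u : Matrix V V A) : Prop where
  isMagic : IsMagic u
  adj_comm : X.adjMatrix A * u = u * X.adjMatrix A

/-- A (nonzero, unital) `C*`-algebra with a matrix that satisfies the relations `u = magic`,
`du = ud` of the graph `X`.

Every `C*`-algebra that is generated by the entries of such a matrix is separable, hence has a copy
in `Type`: no representation of the relations is lost by keeping to `Type`. -/
structure QuantumAutModel {V : Type} [Fintype V] (X : SimpleGraph V) : Type 1 where
  carrier : Type
  [cstar : CStarAlgebra carrier]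
  [nontriv : Nontrivial carrier]
  mat : Matrix V V carrier
  isQuantumAut : IsQuantumAut X mat

namespace QuantumAutModel

variable {V : Type} [Fintype V] {X : SimpleGraph V}

instance (M : QuantumAutModel X) : CStarAlgebra M.carrier := M.cstar

instance (M : QuantumAutModel X) : Nontrivial M.carrier := M.nontriv

end QuantumAutModel

section Universal

variable {V : Type} [Fintype V] (X : SimpleGraph V)

/-- The `ℓ^∞`-product of all models of the relations. -/
abbrev ModelProduct : Type 1 := lp (fun M : QuantumAutModel X => M.carrier) ∞

instance : CStarAlgebra (ModelProduct X) where

/-- The tuple of the `(i, j)` entries of the matrices of all models. -/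
def ModelProduct.entry (i j : V) : ModelProduct X :=
  ⟨fun M => M.mat i j, memℓp_infty ⟨1, by
    rintro _ ⟨M, rfl⟩
    exact IsStarProjection.norm_le _ (M.isQuantumAut.isMagic.isStarProjection i j)⟩⟩

/-- The universal `C*`-algebra `C(G⁺(X))` generated by the entries of a magic matrix `u` with
`du = ud`: the closed `*`-subalgebra generated by the entries of the universal tuple, i.e. the
completion of the polynomials in the `u_ij` for the norm `sup ‖π(·)‖` over all models `π`. -/
def QuantumAutAlgebra : StarSubalgebra ℂ (ModelProduct X) :=
  (StarAlgebra.adjoin ℂ {a | ∃ i j, a = ModelProduct.entry X i j}).topologicalClosure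

instance : CStarAlgebra (QuantumAutAlgebra X) :=
  StarSubalgebra.cstarAlgebra _ (h_closed := StarSubalgebra.isClosed_topologicalClosure _)

/-- The fundamental magic matrix of `C(G⁺(X))`. -/
def QuantumAutAlgebra.u : Matrix V V (QuantumAutAlgebra X) := fun i j =>
  ⟨ModelProduct.entry X i j, StarSubalgebra.le_topologicalClosure _
    (StarAlgebra.subset_adjoin ℂ _ ⟨i, j, rfl⟩)⟩

/-- The dense `*`-subalgebra `⟨u_ij⟩` of `C(G⁺(X))`. -/
def QuantumAutPoly : StarSubalgebra ℂ (QuantumAutAlgebra X) :=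
  StarAlgebra.adjoin ℂ {a | ∃ i j, a = QuantumAutAlgebra.u X i j}

/-- The fundamental magic matrix, with entries in `⟨u_ij⟩`. -/
def QuantumAutPoly.u : Matrix V V (QuantumAutPoly X) := fun i j =>
  ⟨QuantumAutAlgebra.u X i j, StarAlgebra.subset_adjoin ℂ _ ⟨i, j, rfl⟩⟩

/-- The evaluation of `C(G⁺(X))` at a model. -/
def QuantumAutAlgebra.eval (M : QuantumAutModel X) : QuantumAutAlgebra X →⋆ₐ[ℂ] M.carrier where
  toFun a := (a : ModelProduct X) M
  map_one' := rfl
  map_mul' _ _ := rfl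
  map_zero' := rfl
  map_add' _ _ := rfl
  commutes' _ := rfl
  map_star' _ := rfl

/-- The fundamental matrix satisfies the relations of the graph. -/
theorem QuantumAutAlgebra.isQuantumAut : IsQuantumAut X (QuantumAutAlgebra.u X) := by
  classical
  have ext {a b : QuantumAutAlgebra X} (h : ∀ M, eval X M a = eval X M b) : a = b :=
    Subtype.ext (lp.ext (funext h))
  refine ⟨⟨fun i j => ⟨ext fun M => ?_, ext fun M => ?_⟩, fun i => ext fun M => ?_,
    fun j => ext fun M => ?_⟩, Matrix.ext fun i j => ext fun M => ?_⟩
  · exact (M.isQuantumAut.isMagic.isStarProjection i j).isIdempotentElem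
  · exact (M.isQuantumAut.isMagic.isStarProjection i j).isSelfAdjoint
  · rw [map_sum, map_one]
    exact M.isQuantumAut.isMagic.row_sum i
  · rw [map_sum, map_one]
    exact M.isQuantumAut.isMagic.col_sum j
  · have h := congrFun (congrFun M.isQuantumAut.adj_comm i) j
    simp only [SimpleGraph.adjMatrix_mul_apply, SimpleGraph.mul_adjMatrix_apply, map_sum] at h ⊢
    exact h

/-- The universal property of `C(G⁺(X))`. -/
theorem QuantumAutAlgebra.existsUnique_lift {B : Type} [CStarAlgebra B] [Nontrivial B]
    (w : Matrix V V B) (hw : IsQuantumAut X w) :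
    ∃! f : QuantumAutAlgebra X →⋆ₐ[ℂ] B, ∀ i j, f (QuantumAutAlgebra.u X i j) = w i j := by
  refine ⟨eval X ⟨B, w, hw⟩, fun _ _ => rfl, fun f hf => ?_⟩
  have hcont (g : QuantumAutAlgebra X →⋆ₐ[ℂ] B) : Continuous g :=
    AddMonoidHomClass.continuous_of_bound g 1 fun a => by
      simpa using NonUnitalStarAlgHom.norm_apply_le g a
  refine StarAlgHom.ext_topologicalClosure (hcont _) (hcont _) ?_
  refine StarAlgHom.ext_adjoin ?_
  rintro ⟨x, hx⟩ ⟨i, j, rfl⟩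
  exact hf i j

end Universal

/-! ### The group algebra of a discrete group as a Hopf `*`-algebra -/

section GroupAlgebra

variable {Γ : Type*} [Group Γ]

/-- The involution of the group algebra: `(∑ c_g g)* = ∑ conj(c_g) g⁻¹`. -/
instance : Star (MonoidAlgebra ℂ Γ) where
  star a := a.coeff.sum fun g c => MonoidAlgebra.single g⁻¹ (star c)

theorem MonoidAlgebra.star_single' (g : Γ) (c : ℂ) :
    star (MonoidAlgebra.single g c) = MonoidAlgebra.single g⁻¹ (star c) := by
  change (MonoidAlgebra.single g c).coeff.sum _ = _
  rw [MonoidAlgebra.coeff_single]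
  exact Finsupp.sum_single_index (by simp)

theorem MonoidAlgebra.star_add' (a b : MonoidAlgebra ℂ Γ) : star (a + b) = star a + star b := by
  change (a + b).coeff.sum _ = a.coeff.sum _ + b.coeff.sum _
  rw [MonoidAlgebra.coeff_add]
  exact Finsupp.sum_add_index' (by simp) (by simp [MonoidAlgebra.single_add])

instance : StarRing (MonoidAlgebra ℂ Γ) where
  star_involutive a := by
    induction a using MonoidAlgebra.induction_linear with
    | zero => exact Finsupp.sum_zero_index
    | add a b ha hb => rw [MonoidAlgebra.star_add', MonoidAlgebra.star_add', ha, hb]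
    | single g c => simp [MonoidAlgebra.star_single']
  star_mul a b := by
    have h0 : star (0 : MonoidAlgebra ℂ Γ) = 0 := Finsupp.sum_zero_index
    induction a using MonoidAlgebra.induction_linear with
    | zero => simp [h0]
    | add a₁ a₂ h₁ h₂ => simp only [add_mul, mul_add, MonoidAlgebra.star_add', h₁, h₂]
    | single g c =>
      induction b using MonoidAlgebra.induction_linear with
      | zero => simp [h0]
      | add b₁ b₂ h₁ h₂ => simp only [add_mul, mul_add, MonoidAlgebra.star_add', h₁, h₂]
      | single h d =>
        simp [MonoidAlgebra.star_single', MonoidAlgebra.single_mul_single, mul_comm]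
  star_add := MonoidAlgebra.star_add'

end GroupAlgebra

/-! ### The Frucht property -/

/-- Let `A` be the Hopf `*`-algebra of a compact quantum group `G` (for the dual of a group `Γ`, the
group algebra `ℂ[Γ]`). `G` has the Frucht property if `G = G⁺(X)` for some finite graph `X`: there
is an isomorphism of `*`-algebras `⟨u_ij⟩ ≃ A` that intertwines the comultiplications. As the
comultiplication of `G⁺(X)` is the morphism given by `u_ij ↦ ∑_k u_ik ⊗ u_kj` on the generators,
the latter means that the comultiplication of `A` is given by this formula on the images of the
generators. -/
def HasFruchtProperty (A : Type*) [Ring A] [StarRing A] [Bialgebra ℂ A] : Prop :=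
  ∃ (N : ℕ) (X : SimpleGraph (Fin N)) (φ : QuantumAutPoly X ≃⋆ₐ[ℂ] A), ∀ i j,
    Coalgebra.comul (R := ℂ) (φ (QuantumAutPoly.u X i j)) =
      ∑ k, φ (QuantumAutPoly.u X i k) ⊗ₜ[ℂ] φ (QuantumAutPoly.u X k j)

end

/-!
Let `v` be the image in `ℂ[Γ]` of the fundamental magic matrix. Two distinct entries `v_ij`, `v_ik`
of a row have product `0`, and together with `Δ(v_ij) = ∑_k v_ik ⊗ v_kj` this forces the group
elements that occur in a common row to commute. So if `f : Γ → 𝕋` is multiplicative on commuting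
pairs only, then its linear extension still maps `v` to a scalar matrix satisfying the relations of
the graph, and the universal property gives a genuine character of `Γ` that agrees with `f` on the
set `S` of all group elements occurring in `v`.

If commuting is transitive on `Γ ∖ {1}`, any character of a centralizer, extended by `1`, is such a
function `f`. When `Γ` is not commutative, `S` contains noncommuting elements `g` and `h`; they are
then separated by a character of `Γ` trivial on `h` but not on `g`, and by one trivial on `g` but
not on `h`. This is impossible if the subgroups of the abelianization form a chain, as they do for
the groups of order `2`, `3` and `1` that arise from `S₃`, `A₄` and `A₅`.
-/

section MonoidAlgebra

variable {R Γ : Type*} [CommSemiring R]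

/-- The linear functional on the monoid algebra that extends a function `f` on the monoid. -/
noncomputable def linearExtension (f : Γ → R) : MonoidAlgebra R Γ →ₗ[R] R :=
  (MonoidAlgebra.basis Γ R).constr R f

theorem linearExtension_apply (f : Γ → R) (a : MonoidAlgebra R Γ) :
    linearExtension f a = a.coeff.sum fun g c => c * f g := by
  simp only [linearExtension, Module.Basis.constr_apply, smul_eq_mul]
  rfl

@[simp]
theorem linearExtension_single (f : Γ → R) (g : Γ) (c : R) :
    linearExtension f (MonoidAlgebra.single g c) = c * f g := by
  rw [linearExtension_apply, MonoidAlgebra.coeff_single, Finsupp.sum_single_index (zero_mul _)]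

theorem linearExtension_mul [Monoid Γ] {f : Γ → R} {a b : MonoidAlgebra R Γ}
    (hf : ∀ g h, a.coeff g ≠ 0 → b.coeff h ≠ 0 → f (g * h) = f g * f h) :
    linearExtension f (a * b) = linearExtension f a * linearExtension f b := by
  simp only [MonoidAlgebra.mul_def, map_finsuppSum, linearExtension_single]
  rw [linearExtension_apply, linearExtension_apply, Finsupp.sum_mul]
  refine Finsupp.sum_congr fun g hg => ?_
  rw [Finsupp.mul_sum]
  refine Finsupp.sum_congr fun h hh => ?_
  rw [hf g h (Finsupp.mem_support_iff.mp hg) (Finsupp.mem_support_iff.mp hh), mul_mul_mul_comm]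

theorem commute_of_forall_coeff_ne_zero [Monoid Γ] {a b : MonoidAlgebra R Γ}
    (hab : ∀ g h, a.coeff g ≠ 0 → b.coeff h ≠ 0 → Commute g h) : Commute a b := by
  rw [commute_iff_eq, MonoidAlgebra.mul_def, MonoidAlgebra.mul_def, Finsupp.sum_comm]
  refine Finsupp.sum_congr fun h hh => Finsupp.sum_congr fun g hg => ?_
  rw [(hab g h (Finsupp.mem_support_iff.mp hg) (Finsupp.mem_support_iff.mp hh)).eq, mul_comm]

theorem linearExtension_star {Γ : Type*} [Group Γ] {f : Γ → ℂ} (hf : ∀ g, f g⁻¹ = star (f g))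
    (a : MonoidAlgebra ℂ Γ) : linearExtension f (star a) = star (linearExtension f a) := by
  induction a using MonoidAlgebra.induction_linear with
  | zero => simp only [star_zero, map_zero]
  | add a b ha hb => simp only [star_add, map_add, ha, hb]
  | single g c => simp [MonoidAlgebra.star_single', hf]

end MonoidAlgebra

section Corepresentation

/-- A square matrix over a coalgebra is a matrix corepresentation if `Δ(v_ij) = ∑_k v_ik ⊗ v_kj`. -/
def IsMatrixCorep (R : Type*) {V A : Type*} [Fintype V] [CommSemiring R] [AddCommMonoid A]
    [Module R A] [Coalgebra R A] (v : Matrix V V A) : Prop :=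
  ∀ i j, Coalgebra.comul (R := R) (v i j) = ∑ k, v i k ⊗ₜ[R] v k j

/-- The elements of `Γ` that occur in the entries of a matrix over its monoid algebra. -/
def matrixSupport {R V Γ : Type*} [Semiring R] (v : Matrix V V (MonoidAlgebra R Γ)) : Set Γ :=
  {g | ∃ i j, (v i j).coeff g ≠ 0}

namespace IsMatrixCorep

variable {R V Γ : Type*} [Fintype V]

theorem sum_coeff_smul_eq_single [CommSemiring R] {v : Matrix V V (MonoidAlgebra R Γ)}
    (hv : IsMatrixCorep R v) (g : Γ) (i j : V) :
    ∑ k, (v k j).coeff g • v i k = MonoidAlgebra.single g ((v i j).coeff g) := by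
  let slice : MonoidAlgebra R Γ ⊗[R] MonoidAlgebra R Γ →ₗ[R] MonoidAlgebra R Γ :=
    (TensorProduct.rid R (MonoidAlgebra R Γ)).toLinearMap ∘ₗ
      ((MonoidAlgebra.basis Γ R).coord g).lTensor (MonoidAlgebra R Γ)
  have slice_tmul (a b : MonoidAlgebra R Γ) : slice (a ⊗ₜ b) = b.coeff g • a := rfl
  have slice_comul (a : MonoidAlgebra R Γ) :
      slice (Coalgebra.comul a) = MonoidAlgebra.single g (a.coeff g) := by
    classical
    induction a using MonoidAlgebra.induction_linear with
    | zero => simp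
    | add a b ha hb => simp [ha, hb]
    | single h c =>
      obtain rfl | hgh := eq_or_ne h g <;>
        simp [MonoidAlgebra.comul_single, *]
  rw [← slice_comul, hv, map_sum]
  rfl

theorem commute_of_coeff_ne_zero [Monoid Γ] [CommSemiring R] [NoZeroDivisors R]
    {v : Matrix V V (MonoidAlgebra R Γ)} (hv : IsMatrixCorep R v) {i s t : V}
    (horth : Pairwise fun j k => v i j * v i k = 0) {g h : Γ}
    (hg : (v i s).coeff g ≠ 0) (hh : (v i t).coeff h ≠ 0) : Commute g h := by
  -- The cross terms vanish, and what remains is symmetric in `(g, s)` and `(h, t)`.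
  have hprod {g h : Γ} {s t : V} :
      MonoidAlgebra.single (g * h) ((v i s).coeff g * (v i t).coeff h) =
        ∑ j, ((v j s).coeff g * (v j t).coeff h) • (v i j * v i j) := by
    rw [← MonoidAlgebra.single_mul_single, ← hv.sum_coeff_smul_eq_single,
      ← hv.sum_coeff_smul_eq_single, Finset.sum_mul_sum]
    refine Finset.sum_congr rfl fun j _ => ?_
    rw [Finset.sum_eq_single j (fun k _ hkj => ?_) (by simp), smul_mul_smul_comm]
    rw [smul_mul_smul_comm, horth hkj.symm, smul_zero]
  have hsymm : MonoidAlgebra.single (g * h) ((v i s).coeff g * (v i t).coeff h) =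
      MonoidAlgebra.single (h * g) ((v i s).coeff g * (v i t).coeff h) := by
    rw [hprod, mul_comm ((v i s).coeff g), hprod]
    simp only [mul_comm]
  exact (MonoidAlgebra.single_left_inj (mul_ne_zero hg hh)).mp hsymm

theorem single_mem_span [Semifield R] {v : Matrix V V (MonoidAlgebra R Γ)}
    (hv : IsMatrixCorep R v) {g : Γ} {i j : V} (hg : (v i j).coeff g ≠ 0) :
    MonoidAlgebra.single g 1 ∈ Submodule.span R (Set.range (v i)) := by
  have hsum : MonoidAlgebra.single g 1 = ((v i j).coeff g)⁻¹ • ∑ k, (v k j).coeff g • v i k := by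
    rw [hv.sum_coeff_smul_eq_single, MonoidAlgebra.smul_single, smul_eq_mul, inv_mul_cancel₀ hg]
  rw [hsum]
  exact Submodule.smul_mem _ _ (Submodule.sum_mem _ fun k _ =>
    Submodule.smul_mem _ _ (Submodule.subset_span ⟨k, rfl⟩))

end IsMatrixCorep

end Corepresentation

section QuantumAutomorphism

theorem pairwise_mul_eq_zero_of_sum_eq_one {ι A : Type*} [Fintype ι] [CStarAlgebra A] {p : ι → A}
    (hp : ∀ i, IsStarProjection (p i)) (hsum : ∑ i, p i = 1) :
    Pairwise fun i j => p i * p j = 0 := by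
  classical
  let := CStarAlgebra.spectralOrder A
  have := CStarAlgebra.spectralOrderedRing A
  intro i j hij
  have hle : p i ≤ 1 - p j := by
    rw [le_sub_iff_add_le, ← hsum, ← Finset.sum_pair hij]
    exact Finset.sum_le_univ_sum_of_nonneg fun k => (hp k).nonneg
  have hmul := ((hp i).le_iff_mul_eq_left (hp j).one_sub).mp hle
  rwa [mul_sub, mul_one, sub_eq_self] at hmul

theorem IsQuantumAut.map {V A B F : Type*} [Fintype V] [Semiring A] [StarRing A] [Semiring B]
    [StarRing B] [FunLike F A B] [AddMonoidHomClass F A B] {X : SimpleGraph V} {u : Matrix V V A}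
    (hu : IsQuantumAut X u) (L : F) (hL_one : L 1 = 1)
    (hL : ∀ i j, IsStarProjection (L (u i j))) : IsQuantumAut X (u.map L) := by
  classical
  refine ⟨⟨hL, fun i => ?_, fun j => ?_⟩, Matrix.ext fun i j => ?_⟩
  · simp only [Matrix.map_apply, ← map_sum, hu.isMagic.row_sum, hL_one]
  · simp only [Matrix.map_apply, ← map_sum, hu.isMagic.col_sum, hL_one]
  · have hij := congrArg L (congrFun (congrFun hu.adj_comm i) j)
    simpa only [SimpleGraph.adjMatrix_mul_apply, SimpleGraph.mul_adjMatrix_apply, map_sum,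
      Matrix.map_apply] using hij

namespace QuantumAutPoly

variable {V : Type} [Fintype V] (X : SimpleGraph V)

theorem isQuantumAut : IsQuantumAut X (u X) := by
  have hu := QuantumAutAlgebra.isQuantumAut X
  refine ⟨⟨fun i j => ⟨Subtype.ext ?_, Subtype.ext ?_⟩, fun i => Subtype.ext ?_,
    fun j => Subtype.ext ?_⟩, Matrix.ext fun i j => Subtype.ext ?_⟩
  · exact (hu.isMagic.isStarProjection i j).isIdempotentElem
  · exact (hu.isMagic.isStarProjection i j).isSelfAdjoint
  · rw [AddSubmonoidClass.coe_finsetSum]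
    exact hu.isMagic.row_sum i
  · rw [AddSubmonoidClass.coe_finsetSum]
    exact hu.isMagic.col_sum j
  · have hij := congrFun (congrFun hu.adj_comm i) j
    simp only [SimpleGraph.adjMatrix_mul_apply, SimpleGraph.mul_adjMatrix_apply,
      AddSubmonoidClass.coe_finsetSum] at hij ⊢
    exact hij

theorem pairwise_u_mul_u_eq_zero (i : V) : Pairwise fun j k => u X i j * u X i k = 0 := by
  have hu := (QuantumAutAlgebra.isQuantumAut X).isMagic
  exact fun j k hjk => Subtype.ext
    (pairwise_mul_eq_zero_of_sum_eq_one (hu.isStarProjection i) (hu.row_sum i) hjk)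

variable {X}

theorem exists_lift {B : Type} [CStarAlgebra B] [Nontrivial B] {w : Matrix V V B}
    (hw : IsQuantumAut X w) : ∃ F : QuantumAutPoly X →⋆ₐ[ℂ] B, ∀ i j, F (u X i j) = w i j := by
  obtain ⟨F, hF, -⟩ := QuantumAutAlgebra.existsUnique_lift X w hw
  exact ⟨F.comp (QuantumAutPoly X).subtype, hF⟩

theorem isMulCommutative_of_commute (h : ∀ i j k l, Commute (u X i j) (u X k l)) :
    IsMulCommutative (QuantumAutPoly X) := by
  have hu := (QuantumAutAlgebra.isQuantumAut X).isMagic.isStarProjection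
  have hcomm : ∀ i j k l, Commute (QuantumAutAlgebra.u X i j) (QuantumAutAlgebra.u X k l) :=
    fun i j k l => congrArg Subtype.val (h i j k l)
  refine StarAlgebra.isMulCommutative_adjoin ℂ ?_ ?_
  · rintro _ ⟨i, j, rfl⟩ _ ⟨k, l, rfl⟩
    exact hcomm i j k l
  · rintro _ ⟨i, j, rfl⟩ _ ⟨k, l, rfl⟩
    rw [(hu k l).isSelfAdjoint.star_eq]
    exact hcomm i j k l

end QuantumAutPoly

end QuantumAutomorphism

section LocalCharacters

variable {Γ : Type*} [Group Γ]

/-- A local character of a group is a function with values in the unit circle that restricts to a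
character of every commutative subgroup. -/
def IsLocalCharacter (f : Γ → Circle) : Prop :=
  ∀ ⦃g h : Γ⦄, Commute g h → f (g * h) = f g * f h

namespace IsLocalCharacter

variable {f : Γ → Circle}

theorem map_one (hf : IsLocalCharacter f) : f 1 = 1 := by
  simpa using hf (Commute.refl 1)

theorem map_inv (hf : IsLocalCharacter f) (g : Γ) : f g⁻¹ = (f g)⁻¹ := by
  rw [eq_inv_iff_mul_eq_one, ← hf (Commute.refl g).inv_left, inv_mul_cancel, hf.map_one]

theorem isStarProjection_linearExtension (hf : IsLocalCharacter f) {p : MonoidAlgebra ℂ Γ}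
    (hp : IsStarProjection p) (hcomm : ∀ g h, p.coeff g ≠ 0 → p.coeff h ≠ 0 → Commute g h) :
    IsStarProjection (linearExtension (fun g => (f g : ℂ)) p) where
  isIdempotentElem := by
    have hmul (g h : Γ) (hg : p.coeff g ≠ 0) (hh : p.coeff h ≠ 0) :
        (f (g * h) : ℂ) = f g * f h := by
      rw [hf (hcomm g h hg hh), Circle.coe_mul]
    rw [IsIdempotentElem, ← linearExtension_mul hmul, hp.isIdempotentElem.eq]
  isSelfAdjoint := by
    have hstar (g : Γ) : (f g⁻¹ : ℂ) = star (f g : ℂ) := by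
      rw [hf.map_inv, Circle.coe_inv_eq_conj, starRingEnd_apply]
    rw [IsSelfAdjoint, ← linearExtension_star hstar, hp.isSelfAdjoint.star_eq]

end IsLocalCharacter

end LocalCharacters

section QuantumAutomorphismGroupDual

variable {V : Type} [Fintype V] {X : SimpleGraph V} {Γ : Type*} [Group Γ]
  {φ : QuantumAutPoly X ≃⋆ₐ[ℂ] MonoidAlgebra ℂ Γ}

theorem IsMatrixCorep.commute_of_coeff_map_u_ne_zero
    (hφ : IsMatrixCorep ℂ ((QuantumAutPoly.u X).map φ)) {i s t : V} {g h : Γ}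
    (hg : (φ (QuantumAutPoly.u X i s)).coeff g ≠ 0)
    (hh : (φ (QuantumAutPoly.u X i t)).coeff h ≠ 0) : Commute g h := by
  refine hφ.commute_of_coeff_ne_zero (fun j k hjk => ?_) hg hh
  have hmul := congrArg φ (QuantumAutPoly.pairwise_u_mul_u_eq_zero X i hjk)
  rwa [map_mul, map_zero] at hmul

theorem IsLocalCharacter.exists_character_eq_on_matrixSupport {f : Γ → Circle}
    (hf : IsLocalCharacter f) (hφ : IsMatrixCorep ℂ ((QuantumAutPoly.u X).map φ)) :
    ∃ ψ : Γ →* ℂˣ, ∀ g ∈ matrixSupport ((QuantumAutPoly.u X).map φ), (ψ g : ℂ) = f g := by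
  let fExt := linearExtension fun g => (f g : ℂ)
  have hu := QuantumAutPoly.isQuantumAut X
  have hmodel : IsQuantumAut X ((QuantumAutPoly.u X).map (fExt.toAddMonoidHom.comp φ)) :=
    hu.map _ (by simp [fExt, MonoidAlgebra.one_def, hf.map_one]) fun i j =>
      hf.isStarProjection_linearExtension ((hu.isMagic.isStarProjection i j).map φ)
        fun _ _ => hφ.commute_of_coeff_map_u_ne_zero
  obtain ⟨F, hF⟩ := QuantumAutPoly.exists_lift hmodel
  let Ψ : MonoidAlgebra ℂ Γ →ₐ[ℂ] ℂ :=
    (F.comp (φ.symm : MonoidAlgebra ℂ Γ →⋆ₐ[ℂ] QuantumAutPoly X)).toAlgHom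
  have hΨ (i j : V) : Ψ (φ (QuantumAutPoly.u X i j)) = fExt (φ (QuantumAutPoly.u X i j)) :=
    (congrArg F (φ.symm_apply_apply _)).trans (hF i j)
  refine ⟨((Ψ : MonoidAlgebra ℂ Γ →* ℂ).comp (MonoidAlgebra.of ℂ Γ)).toHomUnits, ?_⟩
  rintro g ⟨i, j, hij⟩
  have hrow : Set.EqOn Ψ.toLinearMap fExt (Set.range ((QuantumAutPoly.u X).map φ i)) := by
    rintro _ ⟨k, rfl⟩
    exact hΨ i k
  have hg : Ψ (MonoidAlgebra.single g 1) = fExt (MonoidAlgebra.single g 1) :=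
    LinearMap.eqOn_span hrow (hφ.single_mem_span hij)
  simpa [fExt] using hg

theorem QuantumAutPoly.exists_not_commute_mem_matrixSupport
    (φ : QuantumAutPoly X ≃⋆ₐ[ℂ] MonoidAlgebra ℂ Γ) (hne : ¬ IsMulCommutative Γ) :
    ∃ g ∈ matrixSupport ((QuantumAutPoly.u X).map φ),
      ∃ h ∈ matrixSupport ((QuantumAutPoly.u X).map φ), ¬ Commute g h := by
  contrapose! hne
  have hu : IsMulCommutative (QuantumAutPoly X) :=
    QuantumAutPoly.isMulCommutative_of_commute fun i j k l => by
      have hφ_comm : Commute (φ (QuantumAutPoly.u X i j)) (φ (QuantumAutPoly.u X k l)) :=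
        commute_of_forall_coeff_ne_zero fun g h hg hh => hne g ⟨i, j, hg⟩ h ⟨k, l, hh⟩
      simpa using hφ_comm.map φ.symm
  refine ⟨⟨fun g h => MonoidAlgebra.of_injective (R := ℂ) ?_⟩⟩
  rw [map_mul, map_mul]
  simpa using congrArg φ
    (mul_comm' (φ.symm (MonoidAlgebra.of ℂ Γ g)) (φ.symm (MonoidAlgebra.of ℂ Γ h)))

end QuantumAutomorphismGroupDual

section CommutativeTransitive

/-- A commutative transitive group: commuting is a transitive relation on the nontrivial elements.
-/
def IsCommTransitive (Γ : Type*) [Group Γ] : Prop :=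
  ∀ ⦃g h k : Γ⦄, h ≠ 1 → Commute g h → Commute h k → Commute g k

theorem exists_injective_multiplicative_addCircle_rat_to_circle :
    ∃ e : Multiplicative (AddCircle (1 : ℚ)) →* Circle, Function.Injective e := by
  have hle : AddSubgroup.zmultiples (1 : ℚ) ≤
      (AddSubgroup.zmultiples (1 : ℝ)).comap (Rat.castHom ℝ).toAddMonoidHom := by
    simp
  let toReal : AddCircle (1 : ℚ) →+ AddCircle (1 : ℝ) := QuotientAddGroup.map _ _ _ hle
  have toReal_injective : Function.Injective toReal := by
    rw [injective_iff_map_eq_zero]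
    intro x hx
    induction x using QuotientAddGroup.induction_on with
    | H q =>
      obtain ⟨n, hn⟩ := (QuotientAddGroup.eq_zero_iff _).mp hx
      have hn_real : (n : ℝ) = (q : ℝ) := by simpa using hn
      have hn_rat : (n : ℚ) = q := mod_cast hn_real
      exact (QuotientAddGroup.eq_zero_iff q).mpr ⟨n, by simpa using hn_rat⟩
  exact ⟨AddCircle.toCircle_addChar.toMonoidHom.comp toReal.toMultiplicative,
    (AddCircle.injective_toCircle one_ne_zero).comp toReal_injective⟩

theorem exists_circle_character_apply_ne_one {G : Type*} [CommGroup G] {g : G} (hg : g ≠ 1) :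
    ∃ χ : G →* Circle, χ g ≠ 1 := by
  obtain ⟨c, hc⟩ :=
    CharacterModule.exists_character_apply_ne_zero_of_ne_zero (a := Additive.ofMul g) hg
  obtain ⟨e, he⟩ := exists_injective_multiplicative_addCircle_rat_to_circle
  exact ⟨e.comp (AddMonoidHom.toMultiplicativeRight c), (map_ne_one_iff e he).mpr hc⟩

theorem isLocalCharacter_extend {Γ : Type*} [Group Γ] {H : Subgroup Γ}
    (hH : ∀ ⦃g h : Γ⦄, g ∈ H → g ≠ 1 → Commute g h → h ∈ H) (χ : H →* Circle) :
    IsLocalCharacter (Function.extend Subtype.val χ 1) := by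
  have extend_mem (g : Γ) (hg : g ∈ H) : Function.extend Subtype.val χ 1 g = χ ⟨g, hg⟩ :=
    Subtype.val_injective.extend_apply χ 1 ⟨g, hg⟩
  have extend_eq_one (g : Γ) (hg : g ∈ H → g = 1) : Function.extend Subtype.val χ 1 g = 1 := by
    by_cases hmem : g ∈ H
    · obtain rfl := hg hmem
      rw [extend_mem 1 hmem]
      exact map_one χ
    · exact Function.extend_apply' _ _ _ fun ⟨x, hx⟩ => hmem (hx ▸ x.2)
  intro g h hgh
  by_cases hex : ∃ x ∈ H, x ≠ 1 ∧ Commute x g ∧ Commute x h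
  · obtain ⟨x, hxH, hx, hxg, hxh⟩ := hex
    have hg := hH hxH hx hxg
    have hh := hH hxH hx hxh
    rw [extend_mem g hg, extend_mem h hh, extend_mem _ (mul_mem hg hh), ← map_mul]
    rfl
  · push Not at hex
    rw [extend_eq_one g fun hg => by_contra fun hg1 => hex g hg hg1 (Commute.refl g) hgh,
      extend_eq_one h fun hh => by_contra fun hh1 => hex h hh hh1 hgh.symm (Commute.refl h),
      extend_eq_one (g * h) fun hm => by_contra fun hm1 =>
        hex (g * h) hm hm1 ((Commute.refl g).mul_left hgh.symm) (hgh.mul_left (Commute.refl h)),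
      mul_one]

open scoped IsMulCommutative in
theorem IsCommTransitive.exists_isLocalCharacter {Γ : Type*} [Group Γ] (hct : IsCommTransitive Γ)
    {g h : Γ} (hgh : ¬ Commute g h) : ∃ f : Γ → Circle, IsLocalCharacter f ∧ f g ≠ 1 ∧ f h = 1 := by
  have hg1 : g ≠ 1 := fun hg => hgh (hg ▸ Commute.one_left h)
  have mem_centralizer {x : Γ} : x ∈ Subgroup.centralizer {g} ↔ Commute x g :=
    Subgroup.mem_centralizer_singleton_iff
  have hg : g ∈ Subgroup.centralizer {g} := mem_centralizer.mpr (Commute.refl g)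
  have : IsMulCommutative (Subgroup.centralizer {g}) := ⟨⟨fun x y => Subtype.ext
    (hct hg1 (mem_centralizer.mp x.2) (mem_centralizer.mp y.2).symm)⟩⟩
  obtain ⟨χ, hχ⟩ := exists_circle_character_apply_ne_one (G := Subgroup.centralizer {g})
    (g := ⟨g, hg⟩) (fun h => hg1 (congrArg Subtype.val h))
  refine ⟨Function.extend Subtype.val χ 1, isLocalCharacter_extend (fun x y hx hx1 hxy => ?_) χ,
    ?_, ?_⟩
  · exact mem_centralizer.mpr (hct hx1 hxy.symm (mem_centralizer.mp hx))
  · exact (Subtype.val_injective.extend_apply χ 1 ⟨g, hg⟩).trans_ne hχ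
  · exact Function.extend_apply' _ _ _ fun ⟨x, hx⟩ => hgh (hx ▸ mem_centralizer.mp x.2).symm

end CommutativeTransitive

theorem map_eq_one_of_zpowers_abelianization_le {G A : Type*} [Group G] [CommGroup A] (ψ : G →* A)
    {g h : G}
    (hle : Subgroup.zpowers (Abelianization.of g) ≤ Subgroup.zpowers (Abelianization.of h))
    (hh : ψ h = 1) : ψ g = 1 := by
  rw [← Abelianization.lift_apply_of ψ] at hh ⊢
  obtain ⟨n, hn⟩ := Subgroup.mem_zpowers_iff.mp (Subgroup.zpowers_le.mp hle)
  rw [← hn, map_zpow, hh, one_zpow]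

theorem mainTheorem2_general {Γ : Type*} [Group Γ] (hct : IsCommTransitive Γ)
    (hchain : ∀ H K : Subgroup (Abelianization Γ), H ≤ K ∨ K ≤ H) (hne : ¬ IsMulCommutative Γ) :
    ¬ HasFruchtProperty (MonoidAlgebra ℂ Γ) := by
  rintro ⟨N, X, φ, hφ⟩
  obtain ⟨g, hg, h, hh, hgh⟩ := QuantumAutPoly.exists_not_commute_mem_matrixSupport φ hne
  have hsep {a b : Γ} (ha : a ∈ matrixSupport ((QuantumAutPoly.u X).map φ))
      (hb : b ∈ matrixSupport ((QuantumAutPoly.u X).map φ)) (hab : ¬ Commute a b) :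
      ¬ Subgroup.zpowers (Abelianization.of a) ≤ Subgroup.zpowers (Abelianization.of b) := by
    intro hle
    obtain ⟨f, hf, hfa, hfb⟩ := hct.exists_isLocalCharacter hab
    obtain ⟨ψ, hψ⟩ := hf.exists_character_eq_on_matrixSupport hφ
    have hψb : ψ b = 1 := by simp [Units.ext_iff, hψ b hb, hfb]
    have hψa := map_eq_one_of_zpowers_abelianization_le ψ hle hψb
    exact hfa (Circle.ext (by rw [← hψ a ha, hψa, Units.val_one, Circle.coe_one]))
  rcases hchain (Subgroup.zpowers (Abelianization.of g)) (Subgroup.zpowers (Abelianization.of h))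
    with hle | hle
  · exact hsep hg hh hgh hle
  · exact hsep hh hg (fun h => hgh h.symm) hle

section SmallGroups

open Equiv
open scoped Finset

theorem isMulCommutative_of_card_le_five {G : Type*} [Group G] [Finite G] (hG : Nat.card G ≤ 5) :
    IsMulCommutative G := by
  have hpos : 0 < Nat.card G := Nat.card_pos
  have hcard : Nat.card G ∣ 2 ∨ Nat.card G ∣ 3 ∨ Nat.card G = 2 ^ 2 ∨ Nat.card G ∣ 5 := by
    interval_cases Nat.card G <;> decide
  have := Fact.mk Nat.prime_five
  obtain hcard | hcard | hcard | hcard := hcard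
  · exact (isCyclic_of_card_dvd_prime hcard).isMulCommutative
  · exact (isCyclic_of_card_dvd_prime hcard).isMulCommutative
  · exact IsPGroup.isMulCommutative_of_card_eq_prime_sq hcard
  · exact (isCyclic_of_card_dvd_prime hcard).isMulCommutative

theorem IsCommTransitive.of_card_commute_le_five {Γ : Type*} [Group Γ] [Fintype Γ] [DecidableEq Γ]
    (hcard : ∀ g : Γ, g ≠ 1 → #{k | k * g = g * k} ≤ 5) : IsCommTransitive Γ := by
  intro g h k hh hgh hhk
  have mem_centralizer {x : Γ} : x ∈ Subgroup.centralizer {h} ↔ x * h = h * x :=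
    Subgroup.mem_centralizer_singleton_iff
  have hle : Nat.card (Subgroup.centralizer {h}) ≤ 5 := by
    refine le_of_eq_of_le ?_ (hcard h hh)
    rw [← Nat.card_eq_finsetCard]
    exact Nat.card_congr (Equiv.subtypeEquivRight fun x => by simp [mem_centralizer])
  have := isMulCommutative_of_card_le_five hle
  exact congrArg Subtype.val (mul_comm' (⟨g, mem_centralizer.mpr hgh⟩ : Subgroup.centralizer {h})
    ⟨k, mem_centralizer.mpr hhk.symm⟩)

theorem isCommTransitive_perm_three : IsCommTransitive (Perm (Fin 3)) :=
  .of_card_commute_le_five (by decide)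

theorem isCommTransitive_alternatingGroup_four : IsCommTransitive (alternatingGroup (Fin 4)) :=
  .of_card_commute_le_five (by decide +kernel)

theorem isCommTransitive_alternatingGroup_five : IsCommTransitive (alternatingGroup (Fin 5)) :=
  .of_card_commute_le_five (by decide +kernel)

theorem le_total_of_card_dvd_prime {G : Type*} [Group G] {p : ℕ} (hp : p.Prime)
    (hG : Nat.card G ∣ p) (H K : Subgroup G) : H ≤ K ∨ K ≤ H := by
  rcases (Nat.dvd_prime hp).mp hG with hcard | hcard
  · have := (Nat.card_eq_one_iff_unique.mp hcard).1
    exact .inl (Subsingleton.elim H K).le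
  · have := Fact.mk (hcard ▸ hp : (Nat.card G).Prime)
    rcases H.eq_bot_or_eq_top_of_prime_card with rfl | rfl
    · exact .inl bot_le
    · exact .inr le_top

theorem commutator_perm_three : commutator (Perm (Fin 3)) = alternatingGroup (Fin 3) := by
  have exists_commutator :
      ∀ g : Perm (Fin 3), Perm.sign g = 1 → ∃ a b : Perm (Fin 3), a * b * a⁻¹ * b⁻¹ = g := by
    decide
  refine le_antisymm alternatingGroup.commutator_perm_le fun g hg => ?_
  obtain ⟨a, b, rfl⟩ := exists_commutator g (Perm.mem_alternatingGroup.mp hg)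
  exact Subgroup.commutator_mem_commutator (Subgroup.mem_top a) (Subgroup.mem_top b)

theorem card_abelianization_perm_three : Nat.card (Abelianization (Perm (Fin 3))) = 2 := by
  change (commutator (Perm (Fin 3))).index = 2
  rw [commutator_perm_three, alternatingGroup.index_eq_two]

theorem card_abelianization_alternatingGroup_four :
    Nat.card (Abelianization (alternatingGroup (Fin 4))) = 3 := by
  have hfour : Nat.card (Fin 4) = 4 := Nat.card_fin 4
  have hcommutator : Nat.card (commutator (alternatingGroup (Fin 4))) = 4 := by
    rw [← alternatingGroup.kleinFour_eq_commutator hfour,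
      alternatingGroup.kleinFour_card_of_card_eq_four hfour]
  have hcard : Nat.card (alternatingGroup (Fin 4)) = 12 := by
    rw [nat_card_alternatingGroup, hfour]
    rfl
  have hindex := (commutator (alternatingGroup (Fin 4))).card_mul_index
  rw [hcommutator, hcard] at hindex
  change (commutator (alternatingGroup (Fin 4))).index = 3
  lia

theorem card_abelianization_alternatingGroup_of_five_le {α : Type*} [Fintype α] [DecidableEq α]
    (hα : 5 ≤ Nat.card α) : Nat.card (Abelianization (alternatingGroup α)) = 1 := by
  change (commutator (alternatingGroup α)).index = 1
  rw [commutator_alternatingGroup_eq_top hα, Subgroup.index_top]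

end SmallGroups

theorem mainTheorem2 :
    ¬ HasFruchtProperty (MonoidAlgebra ℂ (Equiv.Perm (Fin 3))) ∧
    ¬ HasFruchtProperty (MonoidAlgebra ℂ (alternatingGroup (Fin 4))) ∧
    ¬ HasFruchtProperty (MonoidAlgebra ℂ (alternatingGroup (Fin 5))) := by
  refine ⟨mainTheorem2_general isCommTransitive_perm_three ?_ ?_,
    mainTheorem2_general isCommTransitive_alternatingGroup_four ?_ ?_,
    mainTheorem2_general isCommTransitive_alternatingGroup_five ?_ ?_⟩
  · exact le_total_of_card_dvd_prime Nat.prime_two card_abelianization_perm_three.dvd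
  · simp [Equiv.Perm.isMulCommutative_iff_card_le_two]
  · exact le_total_of_card_dvd_prime Nat.prime_three card_abelianization_alternatingGroup_four.dvd
  · simp [alternatingGroup.isMulCommutative_iff_card_le_three]
  · refine le_total_of_card_dvd_prime Nat.prime_two ?_
    rw [card_abelianization_alternatingGroup_of_five_le (by simp)]
    exact one_dvd 2
  · simp [alternatingGroup.isMulCommutative_iff_card_le_three]
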